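/- Let $n\ge 1$ and let $D=\{\mathcal D_1,\dots,\mathcal D_n\}$ be probability distributions on $[0,\infty)$. An economy consists of $n$ bidders competing for a single item, where bidder $j$'s value is drawn, independently of the other bidders, from some distribution in $D$ (different bidders may use the same one); it is homogeneous if all $n$ values are drawn i.i.d. from a single $\mathcal D_i$. An auction for an economy is a (possibly randomized) direct mechanism that allocates at most one item, is Bayesian incentive compatible and interim individually rational (with respect to all values in $[0,\infty)$), and has payments of finite expectation; the optimal revenue of an economy is the supremum, in $[0,\infty]$, of the expected revenue (sum of all payments) over all auctions for it. The ideal revenue $\mathsf{OPT}\in[0,\infty]$ is the maximum of the optimal revenue over all economies, i.e. over all $n^n$ ways of assigning distributions from $D$ to the $n$ bidders. Then there is $\mathcal D_i\in D$ such that the homogeneous economy $\mathbf E$ of $n$ bidders with values drawn i.i.d. from $\mathcal D_i$ has optimal revenue at least $\frac12\left(1-\frac1e\right)\mathsf{OPT}$. Moreover, for the same $\mathcal D_i$: if $\mathsf{OPT}<\infty$, then there is a reserve price $r\ge 0$ such that the second-price auction with reserve price $r$ has expected revenue at least $\frac12\left(1-\frac1e\right)\mathsf{OPT}$ in $\mathbf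 E$; if $\mathsf{OPT}=\infty$, then the expected revenues in $\mathbf E$ of second-price auctions with a reserve price have supremum $\infty$ over all reserve prices. -/

import Mathlib

open MeasureTheory
open scoped NNReal ENNReal

/-- An economy with `n` bidders: the (nonnegative) value of bidder `i` is drawn from `E i`,
independently of the other bidders. -/
abbrev Economy (n : ℕ) : Type := Fin n → ProbabilityMeasure ℝ≥0

/-- The joint law of the bidders' values: they are independent, bidder `i` having law `E i`. -/
noncomputable def Economy.law {n : ℕ} (E : Economy n) : Measure (Fin n → ℝ≥0) :=
  Measure.pi fun i => (E i : Measure ℝ≥0)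

/-- A (possibly randomized) direct single-item mechanism for `n` bidders. On the bid profile `w`,
bidder `i` gets the item with probability `alloc w i` and makes the (expected) payment `pay w i`,
which may be negative. -/
structure DirectMechanism (n : ℕ) where
  alloc : (Fin n → ℝ≥0) → Fin n → ℝ
  pay : (Fin n → ℝ≥0) → Fin n → ℝ

namespace DirectMechanism

variable {n : ℕ}

/-- The expected utility of bidder `i` when the bidder's value is `v`, the bidder bids `b`, and all
other bidders bid their values (coordinate `i` of `w` is overwritten, so only the
other coordinates of `w` matter). -/
noncomputable def interimUtility (m : DirectMechanism n) (E : Economy n) (i : Fin n)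
    (v b : ℝ≥0) : ℝ :=
  (v : ℝ) * (∫ w, m.alloc (Function.update w i b) i ∂E.law)
    - ∫ w, m.pay (Function.update w i b) i ∂E.law

/-- `m` is an auction for the economy `E`: it sells at most one item, is Bayesian incentive
compatible and interim individually rational, and its payments have finite expectations. -/
structure IsAuction (m : DirectMechanism n) (E : Economy n) : Prop where
  measurable_alloc : ∀ i, Measurable fun w => m.alloc w i
  measurable_pay : ∀ i, Measurable fun w => m.pay w i
  alloc_nonneg : ∀ w i, 0 ≤ m.alloc w i
  sum_alloc_le_one : ∀ w, ∑ i, m.alloc w i ≤ 1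
  integrable_pay : ∀ i, Integrable (fun w => m.pay w i) E.law
  integrable_interim_pay : ∀ i (b : ℝ≥0),
    Integrable (fun w => m.pay (Function.update w i b) i) E.law
  incentive_compatible : ∀ i (v b : ℝ≥0),
    m.interimUtility E i v b ≤ m.interimUtility E i v v
  individually_rational : ∀ i (v : ℝ≥0), 0 ≤ m.interimUtility E i v v

/-- The expected revenue `𝔼[∑ i, pay i]` under truthful bidding, as the expectation of the positive
part minus that of the negative part. It is `∞` if the payments are nonnegative with
infinite expectation, and it is truncated at `0`, which does not affect suprema over auctions, since
never selling and never charging is an auction. -/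
noncomputable def revenue (m : DirectMechanism n) (E : Economy n) : ℝ≥0∞ :=
  (∫⁻ w, ENNReal.ofReal (∑ i, m.pay w i) ∂E.law)
    - ∫⁻ w, ENNReal.ofReal (-∑ i, m.pay w i) ∂E.law

end DirectMechanism

/-- Bidder `i` wins the second-price auction with reserve price `r`: the bid of `i` meets the
reserve and is a highest bid, and ties are broken in favor of the smallest index. -/
def SecondPriceWins {n : ℕ} (r : ℝ≥0) (w : Fin n → ℝ≥0) (i : Fin n) : Prop :=
  r ≤ w i ∧ (∀ j, w j ≤ w i) ∧ ∀ j, j < i → w j < w i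

open Classical in
/-- The second-price auction with reserve price `r`: the winner pays the larger one of the reserve
price and the highest bid of the other bidders (`0` if there are none). -/
noncomputable def secondPriceAuction (n : ℕ) (r : ℝ≥0) : DirectMechanism n where
  alloc w i := if SecondPriceWins r w i then 1 else 0
  pay w i :=
    if SecondPriceWins r w i then ((max r ((Finset.univ.erase i).sup w) : ℝ≥0) : ℝ) else 0

/-- The revenue of the optimal auction for the economy `E` (a supremum over all auctions). -/
noncomputable def optimalRevenue {n : ℕ} (E : Economy n) : ℝ≥0∞ :=
  ⨆ (m : DirectMechanism n) (_ : m.IsAuction E), m.revenue E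

/-- The homogeneous economy: `n` bidders with values drawn i.i.d. from `μ`. -/
def homogeneousEconomy (n : ℕ) (μ : ProbabilityMeasure ℝ≥0) : Economy n := fun _ => μ

/-- The ideal revenue: the maximum of the optimal revenue over the finitely many ways `σ` to assign
one of the distributions `D 0, …, D (n - 1)` to each one of the `n` bidders, with repetitions. -/
noncomputable def idealRevenue {n : ℕ} (D : Fin n → ProbabilityMeasure ℝ≥0) : ℝ≥0∞ :=
  ⨆ σ : Fin n → Fin n, optimalRevenue fun j => D (σ j)

/-!
Write `q(t) = ℙ(v ≥ t)`. Offering the price `t` to `n` i.i.d. bidders earns `t (1 - (1 - q(t)) ^ n)`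
(`postedRevenue`), and both the second-price auction with reserve `t` and the mechanism selling at
price `t` to the first willing bidder earn at least that. The latter has bounded payments, so it is
an auction for every economy, whereas the payments of the former need not be integrable.

Suppose that no distribution in `D` and no price earn more than `α C`, where
`α = 1 - (1 - 1 / n) ^ n`. As `1 - (1 - q) ^ n ≥ α min(1, n q)` by concavity, every distribution
satisfies `t q(t) ≤ C max(1 / n, q(t)) ≤ C / n + C q(t)` (`price_mul_tail_le`). This bound is affine
in `q(t)`, and an incentive compatible interim rule of a single bidder is a lottery over posted
prices, so it carries over to all such rules without any ironing: a bidder who gets the item with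
probability `x(v)` pays at most `C / n + C 𝔼[x(v)]` in expectation (`integral_pay_le`). Summed over
the bidders of an arbitrary economy, whose winning probabilities add up to at most one, this bounds
the revenue by `2 C` (`DirectMechanism.IsAuction.revenue_le`, `idealRevenue_le`).

Hence the ideal revenue is at most `2 / α` times the supremum of the posted revenues. The inequality
`α > 1 - 1 / e` is strict, so if the ideal revenue is finite and nonzero, then some price attains
the claimed fraction, although the supremum need not be attained. If the ideal revenue is infinite,
then so is the supremum over prices for one of the finitely many distributions.
-/

/-! ### Single-bidder mechanisms as lotteries over posted prices -/

/-- The least value at which the allocation rule `x` exceeds the level `u`, with value `∞` if `x`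
never does. For `u` uniform on `(0, 1]` these are the random posted prices that implement `x`. -/
noncomputable def thresholdPrice (x : ℝ≥0 → ℝ) (u : ℝ) : ℝ≥0∞ :=
  ⨅ (s : ℝ≥0) (_ : u < x s), (s : ℝ≥0∞)

lemma thresholdPrice_mono (x : ℝ≥0 → ℝ) : Monotone (thresholdPrice x) := by
  intro u u' h
  exact iInf_mono fun s => le_iInf fun hs => iInf_le_of_le (h.trans_lt hs) le_rfl

lemma thresholdPrice_le {x : ℝ≥0 → ℝ} {u : ℝ} {s : ℝ≥0} (h : u < x s) :
    thresholdPrice x u ≤ s := iInf₂_le s h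

lemma le_thresholdPrice {x : ℝ≥0 → ℝ} (hx : Monotone x) {u : ℝ} {s : ℝ≥0} (h : x s ≤ u) :
    (s : ℝ≥0∞) ≤ thresholdPrice x u :=
  le_iInf₂ fun b hb => by
    exact_mod_cast (hx.reflect_lt (h.trans_lt hb)).le

/-- The expected payment of a bidder of value `v` facing the random price `thresholdPrice x u`, for
`u` uniform on `(0, 1]`, and buying if `u < x v`. -/
noncomputable def thresholdPayment (x : ℝ≥0 → ℝ) (v : ℝ≥0) : ℝ≥0∞ :=
  ∫⁻ u in Set.Ioc (0 : ℝ) 1, {u | u < x v}.indicator (thresholdPrice x) u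

lemma thresholdPayment_add_le {x : ℝ≥0 → ℝ} (hx : Monotone x) (hx0 : ∀ v, 0 ≤ x v)
    (hx1 : ∀ v, x v ≤ 1) {s v : ℝ≥0} (hsv : s ≤ v) :
    thresholdPayment x s + ENNReal.ofReal (s * (x v - x s)) ≤ thresholdPayment x v := by
  have hvol : ENNReal.ofReal (s * (x v - x s)) =
      ∫⁻ u in Set.Ioc (0 : ℝ) 1, (Set.Ioo (x s) (x v)).indicator (fun _ => (s : ℝ≥0∞)) u := by
    rw [lintegral_indicator measurableSet_Ioo, lintegral_const, Measure.restrict_apply_univ,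
      Measure.restrict_apply measurableSet_Ioo, Set.inter_eq_left.2, Real.volume_Ioo,
      ENNReal.ofReal_mul s.coe_nonneg, ENNReal.ofReal_coe_nnreal]
    exact fun u hu => ⟨(hx0 s).trans_lt hu.1, hu.2.le.trans (hx1 v)⟩
  rw [hvol, thresholdPayment, thresholdPayment,
    ← lintegral_add_right _ (measurable_const.indicator measurableSet_Ioo)]
  refine lintegral_mono fun u => ?_
  by_cases h1 : u < x s
  · have h2 : u ∉ Set.Ioo (x s) (x v) := fun h => h.1.not_gt h1
    have h3 : u < x v := h1.trans_le (hx hsv)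
    simp [Set.indicator, h1, h2, h3]
  · by_cases h2 : u ∈ Set.Ioo (x s) (x v)
    · have := le_thresholdPrice hx h2.1.le
      simpa [Set.indicator, h1, h2.1, h2.2] using this
    · rw [Set.indicator_of_notMem h2, Set.indicator_of_notMem (by exact h1)]; simp

lemma monotone_of_incentiveCompatible {x p : ℝ≥0 → ℝ}
    (hic : ∀ v b : ℝ≥0, (v : ℝ) * x b - p b ≤ v * x v - p v) : Monotone x := by
  intro s v hsv
  rcases hsv.eq_or_lt with rfl | h
  · rfl
  · have h1 := hic v s
    have h2 := hic s v
    have h3 : (s : ℝ) < v := by exact_mod_cast h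
    nlinarith

/-- The payment half of Myerson's lemma: among the payment rules that make `x` incentive compatible
and individually rational, none charges more than the random posted price does. -/
lemma ofReal_pay_le_thresholdPayment {x p : ℝ≥0 → ℝ} (hx0 : ∀ v, 0 ≤ x v)
    (hx1 : ∀ v, x v ≤ 1) (hic : ∀ v b : ℝ≥0, (v : ℝ) * x b - p b ≤ v * x v - p v)
    (hir : ∀ v : ℝ≥0, 0 ≤ v * x v - p v) (v : ℝ≥0) :
    ENNReal.ofReal (p v) ≤ thresholdPayment x v := by
  have hx := monotone_of_incentiveCompatible hic
  -- Between neighbouring points `s ≤ v` of a grid, incentive compatibility bounds the increase of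
  -- `p` by `v * (x v - x s)`, while the threshold payment grows by at least `s * (x v - x s)`. The
  -- gaps `h * (x v - x s)` telescope.
  have grid : ∀ (h : ℝ≥0) (k : ℕ),
      ENNReal.ofReal (p (k * h) - h * (x (k * h) - x 0)) ≤ thresholdPayment x (k * h) := by
    intro h k
    induction k with
    | zero =>
      have : p 0 ≤ 0 := by simpa using hir 0
      simp [ENNReal.ofReal_eq_zero.2 this]
    | succ k ih =>
      have hle : (k : ℝ≥0) * h ≤ ((k + 1 : ℕ) : ℝ≥0) * h := by
        gcongr; exact_mod_cast k.le_succ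
      refine le_trans ?_ (thresholdPayment_add_le hx hx0 hx1 hle)
      refine le_trans ?_ (add_le_add_left ih _)
      refine le_trans (ENNReal.ofReal_le_ofReal ?_) ENNReal.ofReal_add_le
      have := hic (((k + 1 : ℕ) : ℝ≥0) * h) (k * h)
      push_cast at this ⊢
      linarith
  have hlim : Filter.Tendsto (fun N : ℕ => ENNReal.ofReal (p v - v * ((N : ℝ) + 1)⁻¹))
      Filter.atTop (nhds (ENNReal.ofReal (p v - v * 0))) := by
    refine ENNReal.tendsto_ofReal (tendsto_const_nhds.sub (tendsto_const_nhds.mul ?_))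
    simpa using tendsto_one_div_add_atTop_nhds_zero_nat (𝕜 := ℝ)
  rw [mul_zero, sub_zero] at hlim
  refine le_of_tendsto' hlim fun N => ?_
  have hN := grid (v * ((N : ℝ≥0) + 1)⁻¹) (N + 1)
  have he : ((N + 1 : ℕ) : ℝ≥0) * (v * ((N : ℝ≥0) + 1)⁻¹) = v := by
    push_cast; field_simp
  rw [he] at hN
  refine le_trans (ENNReal.ofReal_le_ofReal ?_) hN
  have h1 : x v - x 0 ≤ 1 := by linarith [hx1 v, hx0 0]
  have h2 : (0 : ℝ) ≤ v * ((N : ℝ) + 1)⁻¹ := by positivity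
  push_cast
  nlinarith

/-- The bound `htail` for the closed half-lines `Ici t` passes to the sets `{v | u < x v}`, which
are empty or half-lines, open or closed. -/
lemma thresholdPrice_mul_measure_le (μ : Measure ℝ≥0) [IsProbabilityMeasure μ] {x : ℝ≥0 → ℝ}
    {A C : ℝ} (hA : 0 ≤ A) (hC : 0 ≤ C)
    (htail : ∀ t : ℝ≥0, t * μ.real (Set.Ici t) ≤ A + C * μ.real (Set.Ici t)) (u : ℝ) :
    thresholdPrice x u * μ {v | u < x v} ≤
      ENNReal.ofReal A + ENNReal.ofReal C * μ {v | u < x v} := by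
  rcases Set.eq_empty_or_nonempty {v | u < x v} with h | ⟨s, hs⟩
  · simp [h]
  obtain ⟨t, ht⟩ : ∃ t : ℝ≥0, (t : ℝ≥0∞) = thresholdPrice x u :=
    ⟨_, ENNReal.coe_toNNReal (ne_top_of_le_ne_top ENNReal.coe_ne_top (thresholdPrice_le hs))⟩
  have hsub : {v | u < x v} ⊆ Set.Ici t := fun v hv => by
    have := thresholdPrice_le (x := x) (u := u) hv
    rw [← ht] at this
    exact_mod_cast this
  have hreal : t * μ.real {v | u < x v} ≤ A + C * μ.real {v | u < x v} := by
    have hm := measureReal_mono (μ := μ) hsub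
    have h0 : 0 ≤ μ.real {v | u < x v} := measureReal_nonneg
    -- For `t ≥ C` the set may be enlarged to the half-line `Ici t`.
    rcases le_total (t : ℝ) C with h | h
    · nlinarith
    · nlinarith [htail t]
  rw [← ht, ← ofReal_measureReal (μ := μ), ← ENNReal.ofReal_coe_nnreal,
    ← ENNReal.ofReal_mul t.coe_nonneg, ← ENNReal.ofReal_mul hC,
    ← ENNReal.ofReal_add hA (by positivity)]
  exact ENNReal.ofReal_le_ofReal hreal

lemma lintegral_thresholdPayment_le (μ : Measure ℝ≥0) [IsProbabilityMeasure μ] {x : ℝ≥0 → ℝ}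
    (hx : Monotone x) (hx0 : ∀ v, 0 ≤ x v) {A C : ℝ} (hA : 0 ≤ A) (hC : 0 ≤ C)
    (htail : ∀ t : ℝ≥0, t * μ.real (Set.Ici t) ≤ A + C * μ.real (Set.Ici t)) :
    ∫⁻ v, thresholdPayment x v ∂μ ≤
      ENNReal.ofReal A + ENNReal.ofReal C * ∫⁻ v, ENNReal.ofReal (x v) ∂μ := by
  have hxm : Measurable x := hx.measurable
  have htm : Measurable (thresholdPrice x) := (thresholdPrice_mono x).measurable
  have hset : MeasurableSet {z : ℝ≥0 × ℝ | z.2 < x z.1} :=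
    measurableSet_lt measurable_snd (hxm.comp measurable_fst)
  have hmeas : Measurable (fun z : ℝ≥0 × ℝ =>
      {u | u < x z.1}.indicator (thresholdPrice x) z.2) :=
    (htm.comp measurable_snd).indicator hset
  unfold thresholdPayment
  rw [lintegral_lintegral_swap hmeas.aemeasurable]
  have hinner : ∀ u, ∫⁻ v, {u | u < x v}.indicator (thresholdPrice x) u ∂μ =
      thresholdPrice x u * μ {v | u < x v} := fun u => by
    rw [← lintegral_indicator_const (measurableSet_lt measurable_const hxm)]
    rfl
  simp_rw [hinner]
  rw [lintegral_eq_lintegral_meas_lt μ (Filter.Eventually.of_forall hx0) hxm.aemeasurable]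
  have hmm : Measurable fun u : ℝ => μ {v | u < x v} :=
    (show Antitone fun u : ℝ => μ {v | u < x v} from
      fun a b h => measure_mono fun v hv => lt_of_le_of_lt h hv).measurable
  calc ∫⁻ u in Set.Ioc (0 : ℝ) 1, thresholdPrice x u * μ {v | u < x v}
      ≤ ∫⁻ u in Set.Ioc (0 : ℝ) 1, (ENNReal.ofReal A + ENNReal.ofReal C * μ {v | u < x v}) :=
        lintegral_mono fun u => thresholdPrice_mul_measure_le μ hA hC htail u
    _ = ENNReal.ofReal A + ENNReal.ofReal C * ∫⁻ u in Set.Ioc (0 : ℝ) 1, μ {v | u < x v} := by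
        rw [lintegral_add_left measurable_const, lintegral_const_mul _ hmm]
        simp
    _ ≤ _ := by
        gcongr
        exact Set.Ioc_subset_Ioi_self

/-- A bound on posted-price revenues that is affine in the probability of sale extends to every
incentive compatible and individually rational mechanism for one bidder. -/
theorem integral_pay_le (μ : Measure ℝ≥0) [IsProbabilityMeasure μ] {x p : ℝ≥0 → ℝ}
    (hx0 : ∀ v, 0 ≤ x v) (hx1 : ∀ v, x v ≤ 1)
    (hic : ∀ v b : ℝ≥0, (v : ℝ) * x b - p b ≤ v * x v - p v)
    (hir : ∀ v : ℝ≥0, 0 ≤ v * x v - p v) (hp : Integrable p μ) {A C : ℝ} (hA : 0 ≤ A)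
    (hC : 0 ≤ C) (htail : ∀ t : ℝ≥0, t * μ.real (Set.Ici t) ≤ A + C * μ.real (Set.Ici t)) :
    ∫ v, p v ∂μ ≤ A + C * ∫ v, x v ∂μ := by
  have hx := monotone_of_incentiveCompatible hic
  have hxi : Integrable x μ := Integrable.of_bound hx.measurable.aestronglyMeasurable 1
    (Filter.Eventually.of_forall fun v => by rw [Real.norm_of_nonneg (hx0 v)]; exact hx1 v)
  have hxn : 0 ≤ ∫ v, x v ∂μ := integral_nonneg hx0
  have key : ∫⁻ v, ENNReal.ofReal (p v) ∂μ ≤ ENNReal.ofReal (A + C * ∫ v, x v ∂μ) := by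
    rw [ENNReal.ofReal_add hA (by positivity), ENNReal.ofReal_mul hC,
      ofReal_integral_eq_lintegral_ofReal hxi (Filter.Eventually.of_forall hx0)]
    exact (lintegral_mono fun v => ofReal_pay_le_thresholdPayment hx0 hx1 hic hir v).trans
      (lintegral_thresholdPayment_le μ hx hx0 hA hC htail)
  rw [integral_eq_lintegral_pos_part_sub_lintegral_neg_part hp]
  have := ENNReal.toReal_le_of_le_ofReal (by positivity) key
  linarith [ENNReal.toReal_nonneg (a := ∫⁻ v, ENNReal.ofReal (-p v) ∂μ)]

/-! ### From interim to ex-ante expectations -/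

instance Economy.isProbabilityMeasure_law {n : ℕ} (E : Economy n) : IsProbabilityMeasure E.law := by
  unfold Economy.law; infer_instance

/-- Redrawing the value of bidder `i` does not change the joint law. -/
lemma measurePreserving_update {n : ℕ} (E : Economy n) (i : Fin n) :
    MeasurePreserving (fun z : ℝ≥0 × (Fin n → ℝ≥0) => Function.update z.2 i z.1)
      ((E i : Measure ℝ≥0).prod E.law) E.law := by
  have hm : Measurable (fun z : ℝ≥0 × (Fin n → ℝ≥0) => Function.update z.2 i z.1) := by
    refine measurable_pi_lambda _ fun j => ?_
    by_cases h : j = i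
    · subst h; simpa using measurable_fst
    · simpa [h, Function.comp_def] using (measurable_pi_apply j).comp (measurable_snd (α := ℝ≥0))
  refine ⟨hm, (Measure.pi_eq fun s hs => ?_).symm⟩
  rw [Measure.map_apply hm (MeasurableSet.univ_pi hs)]
  have : (fun z : ℝ≥0 × (Fin n → ℝ≥0) => Function.update z.2 i z.1) ⁻¹' Set.univ.pi s =
      s i ×ˢ Set.univ.pi (Function.update s i Set.univ) := by
    ext z
    simp only [Set.mem_preimage, Set.mem_univ_pi, Set.mem_prod]
    constructor
    · intro h
      refine ⟨by simpa using h i, fun j => ?_⟩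
      by_cases hj : j = i
      · subst hj; simp
      · simpa [hj] using h j
    · rintro ⟨h, h'⟩ j
      by_cases hj : j = i
      · subst hj; simpa using h
      · simpa [hj] using h' j
  rw [this, Measure.prod_prod, Economy.law, Measure.pi_pi,
    ← Finset.mul_prod_erase _ _ (Finset.mem_univ i),
    ← Finset.mul_prod_erase (a := i) Finset.univ (fun j => (E j : Measure ℝ≥0) (s j))
      (Finset.mem_univ i)]
  simp only [Function.update_self, measure_univ, one_mul]
  congr 1
  refine Finset.prod_congr rfl fun j hj => ?_
  rw [Function.update_of_ne (Finset.ne_of_mem_erase hj)]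

namespace DirectMechanism.IsAuction

variable {n : ℕ} {m : DirectMechanism n} {E : Economy n}

lemma alloc_le_one (h : m.IsAuction E) (w : Fin n → ℝ≥0) (i : Fin n) : m.alloc w i ≤ 1 :=
  (Finset.single_le_sum (fun j _ => h.alloc_nonneg w j) (Finset.mem_univ i)).trans
    (h.sum_alloc_le_one w)

lemma integrable_alloc (h : m.IsAuction E) (i : Fin n) :
    Integrable (fun w => m.alloc w i) E.law :=
  Integrable.of_bound (h.measurable_alloc i).aestronglyMeasurable 1
    (Filter.Eventually.of_forall fun w => by
      rw [Real.norm_of_nonneg (h.alloc_nonneg w i)]; exact h.alloc_le_one w i)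

lemma integrable_interim_alloc (h : m.IsAuction E) (i : Fin n) (b : ℝ≥0) :
    Integrable (fun w => m.alloc (Function.update w i b) i) E.law :=
  Integrable.of_bound ((h.measurable_alloc i).comp
      (measurable_update_left)).aestronglyMeasurable 1
    (Filter.Eventually.of_forall fun w => by
      rw [Real.norm_of_nonneg (h.alloc_nonneg _ i)]; exact h.alloc_le_one _ i)

end DirectMechanism.IsAuction

lemma integrable_interim {n : ℕ} {E : Economy n} (i : Fin n) {g : (Fin n → ℝ≥0) → ℝ}
    (hg : Integrable g E.law) :
    Integrable (fun b => ∫ w, g (Function.update w i b) ∂E.law) (E i : Measure ℝ≥0) :=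
  ((measurePreserving_update E i).integrable_comp_of_integrable hg).integral_prod_left

lemma integral_interim {n : ℕ} {E : Economy n} (i : Fin n) {g : (Fin n → ℝ≥0) → ℝ}
    (hg : Integrable g E.law) :
    ∫ b, ∫ w, g (Function.update w i b) ∂E.law ∂(E i : Measure ℝ≥0) = ∫ w, g w ∂E.law := by
  have hmp := measurePreserving_update E i
  have h2 := integral_prod _ (hmp.integrable_comp_of_integrable hg)
  simp only [Function.comp_apply] at h2
  rw [← h2]
  conv_rhs => rw [← hmp.map_eq]
  rw [integral_map hmp.measurable.aemeasurable (by rw [hmp.map_eq]; exact hg.1)]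

/-! ### The revenue bound for an arbitrary economy -/

namespace DirectMechanism.IsAuction

variable {n : ℕ} {m : DirectMechanism n} {E : Economy n}

lemma revenue_eq (h : m.IsAuction E) :
    m.revenue E = ENNReal.ofReal (∑ i, ∫ w, m.pay w i ∂E.law) := by
  have hint : Integrable (fun w => ∑ i, m.pay w i) E.law :=
    integrable_finsetSum _ fun i _ => h.integrable_pay i
  rw [← integral_finsetSum _ fun i _ => h.integrable_pay i,
    integral_eq_lintegral_pos_part_sub_lintegral_neg_part hint,
    ENNReal.ofReal_sub _ ENNReal.toReal_nonneg, ENNReal.ofReal_toReal, ENNReal.ofReal_toReal]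
  · rfl
  · exact hint.neg.lintegral_lt_top.ne
  · exact hint.lintegral_lt_top.ne

/-- If the posted-price revenue of each bidder is at most `C / n + C q`, with `q` the probability of
sale, then no auction earns more than `2 C`: the terms `C / n` add up to `C`, and so at most do the
terms `C q`, as there is a single item. -/
theorem revenue_le (h : m.IsAuction E) (hn : 0 < n) {C : ℝ} (hC : 0 ≤ C)
    (htail : ∀ i (t : ℝ≥0), t * (E i : Measure ℝ≥0).real (Set.Ici t) ≤
      C / n + C * (E i : Measure ℝ≥0).real (Set.Ici t)) :
    m.revenue E ≤ ENNReal.ofReal (2 * C) := by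
  have hn' : (0 : ℝ) < n := by exact_mod_cast hn
  rw [h.revenue_eq]
  refine ENNReal.ofReal_le_ofReal ?_
  have hbidder : ∀ i, ∫ w, m.pay w i ∂E.law ≤ C / n + C * ∫ w, m.alloc w i ∂E.law := by
    intro i
    rw [← integral_interim i (h.integrable_pay i), ← integral_interim i (h.integrable_alloc i)]
    refine integral_pay_le _ (fun b => integral_nonneg fun w => h.alloc_nonneg _ i) (fun b => ?_)
      (fun v b => h.incentive_compatible i v b) (fun v => h.individually_rational i v)
      (integrable_interim i (h.integrable_pay i)) (by positivity) hC (htail i)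
    calc _ ≤ ∫ w, (1 : ℝ) ∂E.law :=
          integral_mono (h.integrable_interim_alloc i b) (integrable_const 1)
            fun w => h.alloc_le_one _ i
      _ = 1 := by simp
  have hsum : ∑ i, ∫ w, m.alloc w i ∂E.law ≤ 1 := by
    rw [← integral_finsetSum _ fun i _ => h.integrable_alloc i]
    calc _ ≤ ∫ w, (1 : ℝ) ∂E.law :=
          integral_mono (integrable_finsetSum _ fun i _ => h.integrable_alloc i)
            (integrable_const 1) fun w => h.sum_alloc_le_one w
      _ = 1 := by simp
  calc ∑ i, ∫ w, m.pay w i ∂E.law ≤ ∑ i, (C / n + C * ∫ w, m.alloc w i ∂E.law) :=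
        Finset.sum_le_sum fun i _ => hbidder i
    _ = C + C * ∑ i, ∫ w, m.alloc w i ∂E.law := by
        rw [Finset.sum_add_distrib, ← Finset.mul_sum]
        simp; field_simp
    _ ≤ 2 * C := by nlinarith

end DirectMechanism.IsAuction

/-! ### Posted prices in a homogeneous economy -/

/-- The expected revenue from offering the item at price `r` to `n` bidders with values drawn
i.i.d. from `μ`. -/
noncomputable def postedRevenue (n : ℕ) (μ : ProbabilityMeasure ℝ≥0) (r : ℝ≥0) : ℝ :=
  r * (1 - (1 - (μ : Measure ℝ≥0).real (Set.Ici r)) ^ n)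

lemma postedRevenue_nonneg (n : ℕ) (μ : ProbabilityMeasure ℝ≥0) (r : ℝ≥0) :
    0 ≤ postedRevenue n μ r := by
  have h1 : (μ : Measure ℝ≥0).real (Set.Ici r) ≤ 1 := measureReal_le_one
  have h0 : 0 ≤ (μ : Measure ℝ≥0).real (Set.Ici r) := measureReal_nonneg
  have := pow_le_one₀ (n := n) (sub_nonneg.2 h1) (by linarith)
  exact mul_nonneg r.coe_nonneg (by linarith)

/-- The probability that at least one of `n` independent events of probability `1 / n` occurs. -/
noncomputable def uniformFactor (n : ℕ) : ℝ := 1 - (1 - 1 / (n : ℝ)) ^ n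

lemma uniformFactor_gt {n : ℕ} (hn : 0 < n) : 1 - 1 / Real.exp 1 < uniformFactor n := by
  have hn' : (1 : ℝ) ≤ n := by exact_mod_cast hn
  have h0 : 0 ≤ 1 - 1 / (n : ℝ) := by
    rw [sub_nonneg, div_le_one (by linarith)]; exact hn'
  have h1 : 1 - 1 / (n : ℝ) < Real.exp (-(1 / n)) := by
    have := Real.add_one_lt_exp (x := -(1 / (n : ℝ))) (by
      have : 0 < 1 / (n : ℝ) := by positivity
      linarith)
    linarith
  have h2 := pow_lt_pow_left₀ h1 h0 hn.ne'
  rw [← Real.exp_nat_mul, mul_neg, mul_one_div_cancel (by linarith), Real.exp_neg] at h2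
  unfold uniformFactor
  rw [one_div (Real.exp 1)]
  linarith

lemma one_sub_inv_exp_pos : 0 < 1 - 1 / Real.exp 1 := by
  have := Real.add_one_lt_exp (x := 1) one_ne_zero
  rw [sub_pos, div_lt_one (Real.exp_pos 1)]
  linarith

lemma uniformFactor_mul_le {n : ℕ} (hn : 0 < n) {q : ℝ} (hq : 0 ≤ q) (hqn : q * n ≤ 1) :
    uniformFactor n * (q * n) ≤ 1 - (1 - q) ^ n := by
  have hn' : (1 : ℝ) ≤ n := by exact_mod_cast hn
  have h0 : 0 ≤ 1 - 1 / (n : ℝ) := by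
    rw [sub_nonneg, div_le_one (by linarith)]; exact hn'
  have h := (convexOn_pow (𝕜 := ℝ) n).2 (Set.mem_Ici.2 zero_le_one) (Set.mem_Ici.2 h0)
    (show 0 ≤ 1 - q * n by linarith) (show 0 ≤ q * n by positivity) (by ring)
  have he : (1 - q * n) • (1 : ℝ) + (q * n) • (1 - 1 / (n : ℝ)) = 1 - q := by
    simp only [smul_eq_mul]; field_simp; ring
  rw [he] at h
  simp only [smul_eq_mul, one_pow] at h
  unfold uniformFactor
  linarith

lemma price_mul_tail_le {n : ℕ} (hn : 0 < n) (μ : ProbabilityMeasure ℝ≥0) {C : ℝ} (hC : 0 ≤ C)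
    {r : ℝ≥0} (h : postedRevenue n μ r ≤ uniformFactor n * C) :
    r * (μ : Measure ℝ≥0).real (Set.Ici r) ≤ C / n + C * (μ : Measure ℝ≥0).real (Set.Ici r) := by
  have hn' : (0 : ℝ) < n := by exact_mod_cast hn
  have ha : 0 < uniformFactor n := one_sub_inv_exp_pos.trans (uniformFactor_gt hn)
  unfold postedRevenue at h
  have hq1 : (μ : Measure ℝ≥0).real (Set.Ici r) ≤ 1 := measureReal_le_one
  have hq0 : 0 ≤ (μ : Measure ℝ≥0).real (Set.Ici r) := measureReal_nonneg
  set q := (μ : Measure ℝ≥0).real (Set.Ici r)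
  have hr := r.coe_nonneg
  have hCn : 0 ≤ C / n := by positivity
  have hCq : 0 ≤ C * q := by positivity
  rcases le_total (q * n) 1 with hq | hq
  · have h1 := mul_le_mul_of_nonneg_left (uniformFactor_mul_le hn hq0 hq) hr
    have h2 : r * (q * n) ≤ C := le_of_mul_le_mul_left (by linarith) ha
    have h3 : r * q ≤ C / n := by rw [le_div_iff₀ hn']; linarith
    linarith
  · have h1 : uniformFactor n ≤ 1 - (1 - q) ^ n := by
      have : (1 - q) ^ n ≤ (1 - 1 / (n : ℝ)) ^ n := by
        refine pow_le_pow_left₀ (by linarith) (sub_le_sub_left ?_ _) n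
        rwa [div_le_iff₀ hn']
      unfold uniformFactor
      linarith
    have h2 : (r : ℝ) ≤ C :=
      le_of_mul_le_mul_left (by linarith [mul_le_mul_of_nonneg_left h1 hr]) ha
    linarith [mul_le_mul_of_nonneg_right h2 hq0]

/-- The bound holds for every assignment of the distributions to the bidders, since the hypothesis
does not depend on the bidder who holds a distribution. -/
theorem idealRevenue_le {n : ℕ} (hn : 0 < n) (D : Fin n → ProbabilityMeasure ℝ≥0) {C : ℝ}
    (hC : 0 ≤ C) (h : ∀ i r, postedRevenue n (D i) r ≤ uniformFactor n * C) :
    idealRevenue D ≤ ENNReal.ofReal (2 * C) :=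
  iSup_le fun _ => iSup₂_le fun _ hm =>
    hm.revenue_le hn hC fun _ t => price_mul_tail_le hn _ hC (h _ t)

/-! ### Mechanisms that earn the posted revenue -/

lemma law_exists_ge (n : ℕ) (μ : ProbabilityMeasure ℝ≥0) (r : ℝ≥0) :
    (homogeneousEconomy n μ).law {w | ∃ i, r ≤ w i} =
      ENNReal.ofReal (1 - (1 - (μ : Measure ℝ≥0).real (Set.Ici r)) ^ n) := by
  have hc : {w : Fin n → ℝ≥0 | ∃ i, r ≤ w i} = (Set.univ.pi fun _ => Set.Iio r)ᶜ := by
    ext w; simp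
  have hm : MeasurableSet (Set.univ.pi fun _ : Fin n => Set.Iio r) :=
    MeasurableSet.univ_pi fun _ => measurableSet_Iio
  have hI : (μ : Measure ℝ≥0).real (Set.Iio r) = 1 - (μ : Measure ℝ≥0).real (Set.Ici r) := by
    rw [← Set.compl_Ici, probReal_compl_eq_one_sub measurableSet_Ici]
  rw [← ofReal_measureReal, hc, probReal_compl_eq_one_sub hm, ← hI]
  simp [Measure.real, Economy.law, homogeneousEconomy, Measure.pi_pi]

lemma DirectMechanism.postedRevenue_le_revenue {n : ℕ} (m : DirectMechanism n)
    (μ : ProbabilityMeasure ℝ≥0) {r : ℝ≥0} (hpay : ∀ w i, 0 ≤ m.pay w i)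
    (hr : ∀ w : Fin n → ℝ≥0, (∃ i, r ≤ w i) → ∃ i, r ≤ m.pay w i) :
    ENNReal.ofReal (postedRevenue n μ r) ≤ m.revenue (homogeneousEconomy n μ) := by
  have hneg : ∀ w, ENNReal.ofReal (-∑ i, m.pay w i) = 0 := fun w =>
    ENNReal.ofReal_eq_zero.2 (neg_nonpos.2 (Finset.sum_nonneg fun i _ => hpay w i))
  have hset : MeasurableSet {w : Fin n → ℝ≥0 | ∃ i, r ≤ w i} := by
    rw [Set.ofPred_exists]
    exact MeasurableSet.iUnion fun i => measurableSet_le measurable_const (measurable_pi_apply i)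
  unfold DirectMechanism.revenue
  simp only [hneg, lintegral_zero, tsub_zero]
  rw [postedRevenue, ENNReal.ofReal_mul r.coe_nonneg, ENNReal.ofReal_coe_nnreal, ← law_exists_ge,
    ← lintegral_indicator_const hset]
  refine lintegral_mono fun w => ?_
  by_cases hw : ∃ i, r ≤ w i
  · obtain ⟨i, hi⟩ := hr w hw
    rw [Set.indicator_of_mem (by exact hw), ← ENNReal.ofReal_coe_nnreal]
    exact ENNReal.ofReal_le_ofReal
      (hi.trans (Finset.single_le_sum (fun j _ => hpay w j) (Finset.mem_univ i)))
  · rw [Set.indicator_of_notMem (by exact hw)]; exact zero_le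

/-- The winner is the first bidder among those with the highest bid. -/
lemma exists_secondPriceWins {n : ℕ} {r : ℝ≥0} {w : Fin n → ℝ≥0} (h : ∃ i, r ≤ w i) :
    ∃ i, SecondPriceWins r w i := by
  obtain ⟨i₀, hi₀⟩ := h
  obtain ⟨k, -, hk⟩ := Finset.exists_max_image Finset.univ w ⟨i₀, Finset.mem_univ i₀⟩
  obtain ⟨i, hi⟩ := exists_minimal_of_wellFoundedLT (fun i => w k ≤ w i) ⟨k, le_rfl⟩
  refine ⟨i, (hi₀.trans (hk i₀ (Finset.mem_univ _))).trans hi.1,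
    fun j => (hk j (Finset.mem_univ _)).trans hi.1, fun j hj => ?_⟩
  exact (not_le.1 (hi.not_prop_of_lt hj)).trans_le hi.1

lemma postedRevenue_le_secondPriceAuction_revenue (n : ℕ) (μ : ProbabilityMeasure ℝ≥0)
    (r : ℝ≥0) : ENNReal.ofReal (postedRevenue n μ r) ≤
      (secondPriceAuction n r).revenue (homogeneousEconomy n μ) := by
  refine DirectMechanism.postedRevenue_le_revenue _ μ (fun w i => ?_) fun w hw => ?_
  · unfold secondPriceAuction
    dsimp only
    split_ifs
    exacts [NNReal.coe_nonneg _, le_rfl]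
  · obtain ⟨i, hi⟩ := exists_secondPriceWins hw
    refine ⟨i, ?_⟩
    simp only [secondPriceAuction, if_pos hi]
    exact_mod_cast le_max_left _ _

open Classical in
/-- The mechanism that sells at price `r` to the bidder of smallest index whose bid meets `r`. -/
noncomputable def postedPriceMechanism (n : ℕ) (r : ℝ≥0) : DirectMechanism n where
  alloc w i := if r ≤ w i ∧ ∀ j, j < i → w j < r then 1 else 0
  pay w i := r * if r ≤ w i ∧ ∀ j, j < i → w j < r then 1 else 0

lemma postedPriceMechanism_isAuction {n : ℕ} (r : ℝ≥0) (E : Economy n) :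
    (postedPriceMechanism n r).IsAuction E := by
  classical
  have hpay : ∀ w i, (postedPriceMechanism n r).pay w i =
    r * (postedPriceMechanism n r).alloc w i := fun _ _ => rfl
  have hm : ∀ i, Measurable fun w => (postedPriceMechanism n r).alloc w i := by
    intro i
    refine Measurable.ite ?_ measurable_const measurable_const
    have hset : {w : Fin n → ℝ≥0 | r ≤ w i ∧ ∀ j, j < i → w j < r} =
        {w | r ≤ w i} ∩ ⋂ j, ⋂ (_ : j < i), {w | w j < r} := by
      ext w; simp
    rw [hset]
    exact (measurableSet_le measurable_const (measurable_pi_apply i)).inter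
      (MeasurableSet.iInter fun j => MeasurableSet.iInter fun _ =>
        measurableSet_lt (measurable_pi_apply j) measurable_const)
  have h0 : ∀ w i, 0 ≤ (postedPriceMechanism n r).alloc w i := by
    intro w i; dsimp only [postedPriceMechanism]; split_ifs <;> simp
  have h1 : ∀ w i, (postedPriceMechanism n r).alloc w i ≤ 1 := by
    intro w i; dsimp only [postedPriceMechanism]; split_ifs <;> simp
  have hint : ∀ {f : (Fin n → ℝ≥0) → (Fin n → ℝ≥0)} (i), Measurable f →
      Integrable (fun w => (postedPriceMechanism n r).alloc (f w) i) E.law := fun i hf =>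
    Integrable.of_bound ((hm i).comp hf).aestronglyMeasurable 1
      (Filter.Eventually.of_forall fun w => by
        rw [Real.norm_of_nonneg (h0 _ i)]; exact h1 _ i)
  have hutil : ∀ i (v b : ℝ≥0), (postedPriceMechanism n r).interimUtility E i v b =
      ∫ w, ((v : ℝ) - r) * (postedPriceMechanism n r).alloc (Function.update w i b) i ∂E.law := by
    intro i v b
    simp only [DirectMechanism.interimUtility, hpay, integral_const_mul]
    ring
  have halloc : ∀ (w : Fin n → ℝ≥0) i b,
      (postedPriceMechanism n r).alloc (Function.update w i b) i =
      if r ≤ b ∧ ∀ j, j < i → w j < r then 1 else 0 := by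
    intro w i b
    have : (∀ j, j < i → Function.update w i b j < r) ↔ ∀ j, j < i → w j < r :=
      forall₂_congr fun j hj => by rw [Function.update_of_ne hj.ne]
    simp only [postedPriceMechanism, Function.update_self, this]
  have hcast : ∀ {v : ℝ≥0}, r ≤ v → (0 : ℝ) ≤ v - r := fun h => sub_nonneg.2 (by exact_mod_cast h)
  have hcast' : ∀ {v : ℝ≥0}, ¬ r ≤ v → (v : ℝ) - r ≤ 0 := fun h =>
    sub_nonpos.2 (by exact_mod_cast (not_le.1 h).le)
  refine ⟨hm, fun i => (hm i).const_mul _, h0, fun w => ?_, fun i => ?_, fun i b => ?_,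
    fun i v b => ?_, fun i v => ?_⟩
  · have hone : (Finset.univ.filter fun i => r ≤ w i ∧ ∀ j, j < i → w j < r).card ≤ 1 := by
      refine Finset.card_le_one.2 fun i hi k hk => ?_
      simp only [Finset.mem_filter, Finset.mem_univ, true_and] at hi hk
      rcases lt_trichotomy i k with h | h | h
      · exact absurd hi.1 (hk.2 i h).not_ge
      · exact h
      · exact absurd hk.1 (hi.2 k h).not_ge
    simp only [postedPriceMechanism, Finset.sum_boole]
    exact_mod_cast hone
  · exact (hint i measurable_id).const_mul _
  · exact (hint i measurable_update_left).const_mul _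
  · rw [hutil, hutil]
    refine integral_mono ((hint i measurable_update_left).const_mul _)
      ((hint i measurable_update_left).const_mul _) fun w => ?_
    simp only [halloc]
    by_cases hv : r ≤ v
    · have := hcast hv
      by_cases hw : ∀ j, j < i → w j < r
      · rw [if_pos (c := r ≤ v ∧ _) ⟨hv, hw⟩]
        split_ifs
        · rfl
        · simpa using this
      · simp [hw]
    · have := hcast' hv
      rw [if_neg (c := r ≤ v ∧ _) (fun h => hv h.1)]
      split_ifs
      · linarith
      · simp
  · rw [hutil]
    refine integral_nonneg fun w => ?_
    simp only [halloc]
    split_ifs with h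
    · simpa using hcast h.1
    · simp

lemma postedRevenue_le_optimalRevenue (n : ℕ) (μ : ProbabilityMeasure ℝ≥0) (r : ℝ≥0) :
    ENNReal.ofReal (postedRevenue n μ r) ≤ optimalRevenue (homogeneousEconomy n μ) := by
  classical
  refine le_iSup₂_of_le _ (postedPriceMechanism_isAuction r _)
    (DirectMechanism.postedRevenue_le_revenue _ μ (fun w i => ?_) fun w hw => ?_)
  · dsimp only [postedPriceMechanism]; split_ifs <;> simp
  · obtain ⟨i, hi⟩ := exists_minimal_of_wellFoundedLT (fun i => r ≤ w i) hw
    refine ⟨i, ?_⟩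
    have : r ≤ w i ∧ ∀ j, j < i → w j < r :=
      ⟨hi.1, fun j hj => not_le.1 fun h => hi.not_prop_of_lt hj h⟩
    simp only [postedPriceMechanism, if_pos this, mul_one, le_refl]

/-! ### Choice of the distribution -/

theorem theorem1 (n : ℕ) (hn : 0 < n) (D : Fin n → ProbabilityMeasure ℝ≥0) :
    ∃ i : Fin n,
      ENNReal.ofReal (1 / 2 * (1 - 1 / Real.exp 1)) * idealRevenue D
          ≤ optimalRevenue (homogeneousEconomy n (D i)) ∧
      (idealRevenue D ≠ ⊤ → ∃ r : ℝ≥0,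
        ENNReal.ofReal (1 / 2 * (1 - 1 / Real.exp 1)) * idealRevenue D
          ≤ (secondPriceAuction n r).revenue (homogeneousEconomy n (D i))) ∧
      (idealRevenue D = ⊤ →
        (⨆ r : ℝ≥0, (secondPriceAuction n r).revenue (homogeneousEconomy n (D i))) = ⊤) := by
  have hc := one_sub_inv_exp_pos
  have hac := uniformFactor_gt hn
  have ha : 0 < uniformFactor n := hc.trans hac
  by_cases htop : idealRevenue D = ⊤
  · obtain ⟨i, hi⟩ : ∃ i, ⨆ r : ℝ≥0, ENNReal.ofReal (postedRevenue n (D i) r) = ⊤ := by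
      by_contra! hne
      -- The sum of the suprema bounds all posted revenues, whatever the distribution.
      set B : Fin n → ℝ := fun i => (⨆ r : ℝ≥0, ENNReal.ofReal (postedRevenue n (D i) r)).toReal
      have hB : ∀ i, 0 ≤ B i := fun i => ENNReal.toReal_nonneg
      have hle : ∀ i r, postedRevenue n (D i) r ≤ B i := fun i r =>
        (ENNReal.ofReal_le_iff_le_toReal (hne i)).1
          (le_iSup (fun r => ENNReal.ofReal (postedRevenue n (D i) r)) r)
      have hS : 0 ≤ ∑ i, B i := Finset.sum_nonneg fun i _ => hB i
      have := idealRevenue_le hn D (C := (∑ i, B i) / uniformFactor n) (by positivity)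
        fun i r => by
          rw [mul_div_cancel₀ _ ha.ne']
          exact (hle i r).trans (Finset.single_le_sum (fun j _ => hB j) (Finset.mem_univ i))
      rw [htop, top_le_iff] at this
      exact ENNReal.ofReal_ne_top this
    refine ⟨i, ?_, fun h => absurd htop h, fun _ => ?_⟩
    · refine le_top.trans (hi.symm.le.trans ?_)
      exact iSup_le fun r => postedRevenue_le_optimalRevenue n (D i) r
    · exact top_le_iff.1 (hi.symm.le.trans (iSup_mono fun r =>
        postedRevenue_le_secondPriceAuction_revenue n (D i) r))
  · obtain ⟨i, r, hir⟩ : ∃ i r, 1 / 2 * (1 - 1 / Real.exp 1) * (idealRevenue D).toReal ≤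
        postedRevenue n (D i) r := by
      by_contra! hlt
      set O := (idealRevenue D).toReal
      have hO : 0 < O := by
        have h1 := hlt ⟨0, hn⟩ 0
        have h2 := postedRevenue_nonneg n (D ⟨0, hn⟩) 0
        have h3 : 0 < 1 / 2 * (1 - 1 / Real.exp 1) * O := h2.trans_lt h1
        exact (mul_pos_iff_of_pos_left (by positivity)).1 h3
      have hle := idealRevenue_le hn D
        (C := 1 / 2 * (1 - 1 / Real.exp 1) * O / uniformFactor n) (by positivity)
        fun i r => by
          rw [mul_div_cancel₀ _ ha.ne']
          exact (hlt i r).le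
      rw [ENNReal.le_ofReal_iff_toReal_le htop (by positivity)] at hle
      have : O ≤ (1 - 1 / Real.exp 1) * O / uniformFactor n := by
        calc O ≤ _ := hle
          _ = _ := by ring
      -- As `O > 0`, this contradicts `1 - 1 / e < uniformFactor n`.
      rw [le_div_iff₀ ha] at this
      nlinarith
    have hle : ENNReal.ofReal (1 / 2 * (1 - 1 / Real.exp 1)) * idealRevenue D ≤
        ENNReal.ofReal (postedRevenue n (D i) r) := by
      rw [← ENNReal.ofReal_toReal htop, ← ENNReal.ofReal_mul (by positivity)]
      exact ENNReal.ofReal_le_ofReal hir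
    exact ⟨i, hle.trans (postedRevenue_le_optimalRevenue n (D i) r),
      fun _ => ⟨r, hle.trans (postedRevenue_le_secondPriceAuction_revenue n (D i) r)⟩,
      fun h => absurd h htop⟩
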